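/- \textbf{Model.} Let $\lambda>0$ and $n\ge 1$. The $n$ items are labelled by their true rank $1,\dots,n$ and have random parameters $\theta_1>\theta_2>\dots>\theta_n$ forming a Poisson point process of rate $\lambda$, i.e. the gaps $X_i=\theta_i-\theta_{i+1}$, $i=1,\dots,n-1$, are i.i.d. exponential random variables of rate $\lambda$. Given $\theta$, comparisons follow the Bradley--Terry (BT) model: each comparison of $i$ and $j$ is independent of the others and yields $i\prec j$ with probability $\frac{1}{1+e^{-(\theta_i-\theta_j)}}$ and $j\prec i$ otherwise. Randomized Quicksort on a finite set $S$ of items returns the list of its elements if $|S|<2$; otherwise it picks a pivot $p\in S$ uniformly at random, compares every $i\in S\setminus\{p\}$ once with $p$, puts $i$ into $L$ if the outcome is $i\prec p$ and into $R$ otherwise, and returns $\mathrm{Quicksort}(L)\cdot p\cdot\mathrm{Quicksort}(R)$. Let $\sigma(i)$ be the position of item $i$ in the list that Quicksort returns on $\{1,\dots,n\}$. \textbf{Theorem.} With high probability, $\max_{1\le i\le n}|\sigma(i)-i| = O(\lambda\log^2 n)$, where the implied constant is uniform over $\lambda$ bounded away from $0$. Precisely: there are constants $c>0$ and $\alpha>0$,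 and for every $\lambda_0>0$ a constant $C>0$ depending only on $\lambda_0$, such that for all $\lambda\ge\lambda_0$ and all $n\ge 1$, $$\mathbf{P}\Bigl(\max_{1\le i\le n}|\sigma(i)-i|\le C\,\lambda\log^2 n\Bigr)\ \ge\ 1-\frac{c}{n^{\alpha}},$$ the probability being over $\theta$, the comparison outcomes and the pivots. -/

import Mathlib

open MeasureTheory ProbabilityTheory
open scoped ENNReal

namespace NoisyQuicksort

/-- Bradley--Terry model with parameters `θ`: the probability that a comparison of `i` and `j`
yields `i ≺ j` (that is, `i` is preferred to `j`). -/
noncomputable def btProb {n : ℕ} (θ : Fin n → ℝ) (i j : Fin n) : ℝ≥0∞ :=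
  ENNReal.ofReal (1 / (1 + Real.exp (-(θ i - θ j))))

theorem btProb_add_swap {n : ℕ} (θ : Fin n → ℝ) (i j : Fin n) :
    btProb θ i j + btProb θ j i = 1 := by
  unfold btProb
  rw [← ENNReal.ofReal_add (by positivity) (by positivity), ← ENNReal.ofReal_one]
  congr 1
  have h : Real.exp (-(θ j - θ i)) = (Real.exp (-(θ i - θ j)))⁻¹ := by
    rw [← Real.exp_neg]; congr 1; ring
  have h' := Real.exp_pos (-(θ i - θ j))
  rw [h]
  field_simp
  ring

/-- The partition operation with pivot `p` applied to the set `T` of the other items. Each `i ∈ T`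
is compared once with `p`, all outcomes being independent and following the Bradley--Terry model;
this is the law of the (random) set `L ⊆ T` of the items `i` whose comparison yields `i ≺ p`. -/
noncomputable def partition {n : ℕ} (θ : Fin n → ℝ) (p : Fin n) (T : Finset (Fin n)) :
    PMF T.powerset :=
  PMF.ofFintype
    (fun L => (∏ i ∈ (L : Finset (Fin n)), btProb θ i p) * ∏ i ∈ T \ L, btProb θ p i)
    (by
      rw [Finset.sum_coe_sort T.powerset (fun L : Finset (Fin n) =>
        (∏ i ∈ L, btProb θ i p) * ∏ i ∈ T \ L, btProb θ p i), ← Finset.prod_add]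
      simp [btProb_add_swap])

/-- Randomized Quicksort on the set `S` of items, with noisy comparisons following the
Bradley--Terry model with parameters `θ`: the law of the returned list. The pivot is uniform on
`S`, and fresh independent randomness is used in every step. -/
noncomputable def quicksort {n : ℕ} (θ : Fin n → ℝ) (S : Finset (Fin n)) :
    PMF (List (Fin n)) :=
  if h : S.card < 2 then PMF.pure S.toList
  else
    haveI : Nonempty S := (Finset.card_pos.mp (by omega)).to_subtype
    (PMF.uniformOfFintype S).bind fun p =>
      (partition θ p (S.erase p)).bind fun L =>
        (quicksort θ L).bind fun l =>
          (quicksort θ (S.erase p \ L)).bind fun r =>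
            PMF.pure (l ++ (p : Fin n) :: r)
termination_by S.card
decreasing_by
  · exact (Finset.card_le_card (Finset.mem_powerset.mp L.2)).trans_lt
      (Finset.card_erase_lt_of_mem p.2)
  · exact (Finset.card_le_card Finset.sdiff_subset).trans_lt (Finset.card_erase_lt_of_mem p.2)

/-- The random list `out` is the output of one run of randomized Quicksort on all `n` items, the
comparisons following the Bradley--Terry model with the random parameters `θ`: conditionally on
`θ`, the law of `out` is `quicksort θ univ`. -/
def IsQuicksortOutput {Ω : Type*} [MeasurableSpace Ω] {n : ℕ} (P : Measure Ω)
    (θ : Ω → Fin n → ℝ) (out : Ω → List (Fin n)) : Prop :=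
  (∀ l, MeasurableSet {ω | out ω = l}) ∧
  ∀ (A : Set (Fin n → ℝ)), MeasurableSet A → ∀ l : List (Fin n),
    P (θ ⁻¹' A ∩ {ω | out ω = l}) = ∫⁻ ω in θ ⁻¹' A, quicksort (θ ω) Finset.univ l ∂P

/-- The gap between the parameters of two consecutive items. -/
def gap {n : ℕ} (θ : Fin n → ℝ) (i : Fin (n - 1)) : ℝ :=
  θ ⟨i, by omega⟩ - θ ⟨i + 1, by omega⟩

/-- The rank (counted from `1`) of item `i` in the list `l`. -/
def rank {n : ℕ} (l : List (Fin n)) (i : Fin n) : ℕ := l.idxOf i + 1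

/-- Maximum displacement `max_i |σ(i) - i|` of the ranking `σ` given by the list `l`; the item
`i : Fin n` has true rank `i + 1`. -/
def maxDisplacement {n : ℕ} (l : List (Fin n)) : ℕ :=
  Finset.univ.sup fun i : Fin n => ((rank l i : ℤ) - ((i : ℕ) + 1 : ℤ)).natAbs

end NoisyQuicksort

/-!
A comparison of two items whose parameters differ by at least `d` is wrong with probability at most
`exp (-d)`, and Quicksort makes at most `n ^ 2` comparisons. For `d = 3 * log n`, with probability
at least `1 - 1 / n` all comparisons of items at distance at least `d` are therefore correct
(`quicksort_not_isNearlySorted_le`, by induction along the recursion). Every pair of items is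
separated by exactly one pivot; if the pivot's comparisons are correct in this sense, each of the
two items is within `d` of the correct side of the pivot, so that the pair can be misordered only
if its parameters differ by less than `2 * d` (`IsNearlySorted.append_cons`).

On the other hand, a Chernoff bound for sums of independent exponential variables shows that, with
probability at least `1 - 1 / n`, items whose ranks differ by at least `m = O(lam * log n)` have
parameters at distance at least `2 * d` (`measure_not_spread_le`). Then only items less than `m`
ranks apart can be misordered, and each item is displaced by at most `m`
(`IsNearlySorted.maxDisplacement_le`). This gives a displacement of order `lam * log n`, which is
at most a constant times `lam * log n ^ 2` for `n ≥ 2`; the constant depends on the lower bound for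
`lam`, both through the Chernoff exponent, which has to be of order `log n`, and through rounding.
-/

namespace NoisyQuicksort

/-! ### Error probabilities of the partition step -/

/-- A comparison that ranks `i` above `j` although `θ j` exceeds `θ i` by `d` is exponentially
unlikely in `d`. -/
theorem btProb_le_exp {n : ℕ} (θ : Fin n → ℝ) {i j : Fin n} {d : ℝ} (h : d ≤ θ j - θ i) :
    btProb θ i j ≤ ENNReal.ofReal (Real.exp (-d)) := by
  refine ENNReal.ofReal_le_ofReal ?_
  have h1 : Real.exp d ≤ Real.exp (-(θ i - θ j)) := Real.exp_le_exp.mpr (by linarith)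
  rw [Real.exp_neg d, ← one_div]
  exact one_div_le_one_div_of_le (Real.exp_pos d) (by linarith)

theorem partition_mem_le {n : ℕ} (θ : Fin n → ℝ) (p : Fin n) {T : Finset (Fin n)} {i : Fin n}
    (hi : i ∈ T) :
    (partition θ p T).toOuterMeasure {L | i ∈ (L : Finset (Fin n))} ≤ btProb θ i p := by
  classical
  set f : Fin n → ℝ≥0∞ := fun k => btProb θ k p
  set g : Fin n → ℝ≥0∞ := fun k => btProb θ p k
  -- Zeroing the factor of `i` on the right kills exactly the sets that miss `i`.
  calc (partition θ p T).toOuterMeasure {L | i ∈ (L : Finset (Fin n))}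
      ≤ ∑ L : T.powerset, (∏ k ∈ (L : Finset (Fin n)), f k) *
          ∏ k ∈ T \ L, (if k = i then 0 else g k) := by
        rw [PMF.toOuterMeasure_apply_fintype]
        refine Finset.sum_le_sum fun L _ => ?_
        by_cases hL : i ∈ (L : Finset (Fin n))
        · rw [Set.indicator_of_mem (by exact hL)]
          refine le_of_eq ?_
          change (∏ k ∈ (L : Finset (Fin n)), f k) * ∏ k ∈ T \ L, g k = _
          congr 1
          refine Finset.prod_congr rfl fun k hk => ?_
          rw [if_neg]
          rintro rfl
          exact (Finset.mem_sdiff.mp hk).2 hL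
        · rw [Set.indicator_of_notMem (by exact hL)]
          exact zero_le
    _ = ∏ k ∈ T, (f k + if k = i then 0 else g k) := by
        rw [Finset.sum_coe_sort T.powerset (fun L : Finset (Fin n) =>
          (∏ k ∈ L, f k) * ∏ k ∈ T \ L, (if k = i then 0 else g k)), ← Finset.prod_add]
    _ = f i := by
        rw [Finset.prod_eq_single_of_mem i hi]
        · simp
        · intro k _ hk
          rw [if_neg hk]
          exact btProb_add_swap θ k p

theorem partition_notMem_le {n : ℕ} (θ : Fin n → ℝ) (p : Fin n) {T : Finset (Fin n)} {i : Fin n}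
    (hi : i ∈ T) :
    (partition θ p T).toOuterMeasure {L | i ∉ (L : Finset (Fin n))} ≤ btProb θ p i := by
  classical
  set f : Fin n → ℝ≥0∞ := fun k => btProb θ k p
  set g : Fin n → ℝ≥0∞ := fun k => btProb θ p k
  calc (partition θ p T).toOuterMeasure {L | i ∉ (L : Finset (Fin n))}
      ≤ ∑ L : T.powerset, (∏ k ∈ (L : Finset (Fin n)), (if k = i then 0 else f k)) *
          ∏ k ∈ T \ L, g k := by
        rw [PMF.toOuterMeasure_apply_fintype]
        refine Finset.sum_le_sum fun L _ => ?_
        by_cases hL : i ∈ (L : Finset (Fin n))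
        · rw [Set.indicator_of_notMem (by exact not_not_intro hL)]
          exact zero_le
        · rw [Set.indicator_of_mem (by exact hL)]
          refine le_of_eq ?_
          change (∏ k ∈ (L : Finset (Fin n)), f k) * ∏ k ∈ T \ L, g k = _
          congr 1
          refine Finset.prod_congr rfl fun k hk => ?_
          rw [if_neg]
          rintro rfl
          exact hL hk
    _ = ∏ k ∈ T, ((if k = i then 0 else f k) + g k) := by
        rw [Finset.sum_coe_sort T.powerset (fun L : Finset (Fin n) =>
          (∏ k ∈ L, (if k = i then 0 else f k)) * ∏ k ∈ T \ L, g k), ← Finset.prod_add]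
    _ = g i := by
        rw [Finset.prod_eq_single_of_mem i hi]
        · simp
        · intro k _ hk
          rw [if_neg hk]
          exact btProb_add_swap θ k p

/-- The set `L` is a partition of `T` by the pivot `p` in which every item on the wrong side of `p`
has a parameter within `d` of that of `p`. -/
def IsAccurate {n : ℕ} (θ : Fin n → ℝ) (d : ℝ) (p : Fin n) (T L : Finset (Fin n)) : Prop :=
  (∀ i ∈ L, θ p - θ i < d) ∧ ∀ i ∈ T \ L, θ i - θ p < d

theorem partition_not_isAccurate_le {n : ℕ} (θ : Fin n → ℝ) {d : ℝ} (hd : 0 < d) (p : Fin n)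
    (T : Finset (Fin n)) :
    (partition θ p T).toOuterMeasure {L | ¬ IsAccurate θ d p T L} ≤
      T.card * ENNReal.ofReal (Real.exp (-d)) := by
  let A : Fin n → Set T.powerset := fun i =>
    {L | (i ∈ (L : Finset (Fin n)) ∧ d ≤ θ p - θ i) ∨
      (i ∉ (L : Finset (Fin n)) ∧ d ≤ θ i - θ p)}
  have hsub : {L : T.powerset | ¬ IsAccurate θ d p T L} ⊆ ⋃ i ∈ T, A i := by
    intro L hL
    simp only [IsAccurate, Set.mem_ofPred_eq, not_and_or, not_forall, not_lt] at hL
    simp only [Set.mem_iUnion]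
    rcases hL with ⟨i, hi, h⟩ | ⟨i, hi, h⟩
    · exact ⟨i, Finset.mem_powerset.mp L.2 hi, Or.inl ⟨hi, h⟩⟩
    · exact ⟨i, (Finset.mem_sdiff.mp hi).1, Or.inr ⟨(Finset.mem_sdiff.mp hi).2, h⟩⟩
  have hA : ∀ i ∈ T, (partition θ p T).toOuterMeasure (A i) ≤
      ENNReal.ofReal (Real.exp (-d)) := by
    intro i hi
    by_cases h : d ≤ θ p - θ i
    · refine le_trans ((partition θ p T).toOuterMeasure.mono ?_)
        ((partition_mem_le θ p hi).trans (btProb_le_exp θ h))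
      rintro L (hL | hL)
      · exact hL.1
      · linarith [hL.2]
    by_cases h' : d ≤ θ i - θ p
    · refine le_trans ((partition θ p T).toOuterMeasure.mono ?_)
        ((partition_notMem_le θ p hi).trans (btProb_le_exp θ h'))
      rintro L (hL | hL)
      · exact absurd hL.2 h
      · exact hL.1
    · have : A i = ∅ := by
        ext L
        simp [A, h, h']
      rw [this]
      simp
  calc _ ≤ (partition θ p T).toOuterMeasure (⋃ i ∈ T, A i) :=
        (partition θ p T).toOuterMeasure.mono hsub
    _ ≤ ∑ i ∈ T, (partition θ p T).toOuterMeasure (A i) := measure_biUnion_finset_le T A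
    _ ≤ ∑ _i ∈ T, ENNReal.ofReal (Real.exp (-d)) := Finset.sum_le_sum hA
    _ = _ := by rw [Finset.sum_const, nsmul_eq_mul]

/-! ### Lists sorted up to a parameter error -/

/-- The list `l` enumerates `S` without repetition, and `b` comes after `a` only if `θ b` exceeds
`θ a` by less than `d`. -/
def IsNearlySorted {n : ℕ} (θ : Fin n → ℝ) (d : ℝ) (S : Finset (Fin n)) (l : List (Fin n)) :
    Prop :=
  l.Nodup ∧ (∀ x, x ∈ l ↔ x ∈ S) ∧ l.Pairwise fun a b => θ b - θ a < d

/-- Items separated by an accurate pivot are each within `d` of the correct side of it, so that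
they are misordered by less than `2 * d`. -/
theorem IsNearlySorted.append_cons {n : ℕ} {θ : Fin n → ℝ} {d : ℝ} (hd : 0 < d)
    {S L : Finset (Fin n)} {p : Fin n} {l r : List (Fin n)} (hp : p ∈ S) (hLS : L ⊆ S.erase p)
    (hL : IsAccurate θ d p (S.erase p) L) (hl : IsNearlySorted θ (2 * d) L l)
    (hr : IsNearlySorted θ (2 * d) (S.erase p \ L) r) :
    IsNearlySorted θ (2 * d) S (l ++ p :: r) := by
  obtain ⟨hl1, hl2, hl3⟩ := hl
  obtain ⟨hr1, hr2, hr3⟩ := hr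
  have hpl : p ∉ l := fun h => by simpa using hLS ((hl2 p).mp h)
  have hpr : p ∉ r := fun h => by simpa using (hr2 p).mp h
  refine ⟨?_, fun x => ?_, ?_⟩
  · rw [List.nodup_append]
    refine ⟨hl1, List.nodup_cons.mpr ⟨hpr, hr1⟩, ?_⟩
    rintro a ha b hb rfl
    rcases List.mem_cons.mp hb with rfl | hb
    · exact hpl ha
    · exact (Finset.mem_sdiff.mp ((hr2 a).mp hb)).2 ((hl2 a).mp ha)
  · simp only [List.mem_append, List.mem_cons, hl2, hr2, Finset.mem_sdiff, Finset.mem_erase]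
    have := @hLS x
    simp only [Finset.mem_erase] at this
    by_cases hx : x = p
    · simp [hx, hp]
    · tauto
  · rw [List.pairwise_append]
    refine ⟨hl3, List.pairwise_cons.mpr ⟨fun b hb => ?_, hr3⟩, fun a ha b hb => ?_⟩
    · linarith [hL.2 b ((hr2 b).mp hb)]
    · have h1 := hL.1 a ((hl2 a).mp ha)
      rcases List.mem_cons.mp hb with rfl | hb
      · linarith
      · linarith [hL.2 b ((hr2 b).mp hb)]

/-- If distant items are in the right order in an enumeration of all items, no item is displaced
far: every item at least `m` ranks above `i` precedes `i`, and every item before `i` lies less than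
`m` ranks below it or is ranked above it. -/
theorem maxDisplacement_le {n m : ℕ} {l : List (Fin n)} (hmem : ∀ i, i ∈ l) (hl : l.Nodup)
    (h : ∀ i j : Fin n, (i : ℕ) + m ≤ j → l.idxOf i ≤ l.idxOf j) :
    maxDisplacement l ≤ m := by
  have hlen : l.length = n := by
    have : l.toFinset = Finset.univ := by ext x; simp [hmem]
    rw [← List.toFinset_card_of_nodup hl, this, Finset.card_univ, Fintype.card_fin]
  have hinj : Function.Injective fun i : Fin n => l.idxOf i := fun i j hij =>
    (List.idxOf_inj (hmem i)).mp hij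
  let σ : Fin n → Fin n := fun i =>
    ⟨l.idxOf i, (List.idxOf_lt_length_of_mem (hmem i)).trans_eq hlen⟩
  have hσ : Function.Bijective σ := by
    refine Finite.injective_iff_bijective.mp fun i j hij => hinj ?_
    simpa [σ] using hij
  have hcard : ∀ i, (Finset.univ.filter fun j => σ j < σ i).card = l.idxOf i := by
    intro i
    have : (Finset.univ.filter fun j => σ j < σ i).map (Equiv.ofBijective σ hσ).toEmbedding =
        Finset.Iio (σ i) := by
      ext k
      obtain ⟨j, rfl⟩ := hσ.2 k
      simp
    rw [← Finset.card_map (Equiv.ofBijective σ hσ).toEmbedding, this, Fin.card_Iio]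
  refine Finset.sup_le fun i _ => ?_
  have hup : l.idxOf i ≤ i + m := by
    rw [← hcard i]
    calc _ ≤ ((Finset.univ.filter fun j : Fin n => (j : ℕ) < i + m).map
            Fin.valEmbedding).card := by
          rw [Finset.card_map]
          refine Finset.card_le_card fun j hj => ?_
          simp only [Finset.mem_filter, Finset.mem_univ, true_and, σ, Fin.mk_lt_mk] at hj ⊢
          by_contra hc
          have := h i j (by omega)
          omega
      _ ≤ (Finset.range (i + m)).card := by
          refine Finset.card_le_card fun k hk => ?_
          simp only [Finset.mem_map, Finset.mem_filter, Finset.mem_univ, true_and,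
            Fin.valEmbedding_apply] at hk
          obtain ⟨j, hj, rfl⟩ := hk
          simpa using hj
      _ = _ := Finset.card_range _
  have hlow : (i : ℕ) ≤ l.idxOf i + m := by
    by_cases him : (i : ℕ) ≤ m
    · omega
    have : (i : ℕ) - m ≤ l.idxOf i := by
      rw [← hcard i]
      calc (i : ℕ) - m = (Finset.Iio (⟨i - m, by omega⟩ : Fin n)).card := by rw [Fin.card_Iio]
        _ ≤ _ := by
          refine Finset.card_le_card fun j hj => ?_
          rw [Finset.mem_Iio, Fin.lt_def] at hj
          simp only at hj
          simp only [Finset.mem_filter, Finset.mem_univ, true_and, σ, Fin.mk_lt_mk]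
          refine lt_of_le_of_ne (h j i (by omega)) fun he => ?_
          have := hinj he
          omega
    omega
  simp only [rank]
  omega

theorem IsNearlySorted.maxDisplacement_le {n m : ℕ} {θ : Fin n → ℝ} {d : ℝ} {l : List (Fin n)}
    (hl : IsNearlySorted θ d Finset.univ l)
    (hθ : ∀ i j : Fin n, (i : ℕ) + m ≤ j → d ≤ θ i - θ j) :
    maxDisplacement l ≤ m := by
  obtain ⟨h1, h2, h3⟩ := hl
  have hmem : ∀ i, i ∈ l := fun i => (h2 i).mpr (Finset.mem_univ i)
  refine NoisyQuicksort.maxDisplacement_le hmem h1 fun i j hij => ?_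
  by_contra! hlt
  have := List.pairwise_iff_getElem.mp h3 (l.idxOf j) (l.idxOf i)
    (List.idxOf_lt_length_of_mem (hmem j)) (List.idxOf_lt_length_of_mem (hmem i)) hlt
  rw [List.getElem_idxOf, List.getElem_idxOf] at this
  linarith [hθ i j hij]

/-! ### Quicksort for fixed parameters -/

/-- Union bound along a bind: the first stage fails, or the second does. -/
theorem toOuterMeasure_bind_le {α β : Type*} (p : PMF α) (f : α → PMF β) {A : Set α} {B : Set β}
    {b c : ℝ≥0∞} (hA : p.toOuterMeasure A ≤ b) (h : ∀ a ∉ A, (f a).toOuterMeasure B ≤ c) :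
    (p.bind f).toOuterMeasure B ≤ b + c := by
  refine le_trans ?_ (add_le_add_left hA c)
  rw [PMF.toOuterMeasure_bind_apply, PMF.toOuterMeasure_apply]
  calc ∑' a, p a * (f a).toOuterMeasure B ≤ ∑' a, (A.indicator p a + p a * c) := by
        refine ENNReal.tsum_le_tsum fun a => ?_
        by_cases ha : a ∈ A
        · rw [Set.indicator_of_mem ha]
          refine le_add_right ?_
          calc p a * (f a).toOuterMeasure B ≤ p a * 1 := by
                gcongr
                rw [PMF.toOuterMeasure_apply, ← (f a).tsum_coe]
                exact ENNReal.tsum_le_tsum fun b => Set.indicator_le_self _ _ _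
            _ = p a := mul_one _
        · rw [Set.indicator_of_notMem ha, zero_add]
          gcongr
          exact h a ha
    _ = _ := by rw [ENNReal.tsum_add, ENNReal.tsum_mul_right, p.tsum_coe, one_mul]

/-- At most `S.card ^ 2` comparisons are made, each of which misplaces an item that is at distance
at least `d` from the pivot with probability at most `exp (-d)`. -/
theorem quicksort_not_isNearlySorted_le {n : ℕ} (θ : Fin n → ℝ) {d : ℝ} (hd : 0 < d)
    (S : Finset (Fin n)) :
    (quicksort θ S).toOuterMeasure {l | ¬ IsNearlySorted θ (2 * d) S l} ≤
      (S.card : ℝ≥0∞) ^ 2 * ENNReal.ofReal (Real.exp (-d)) := by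
  induction hs : S.card using Nat.strong_induction_on generalizing S with
  | _ s ih =>
  subst hs
  set ε := ENNReal.ofReal (Real.exp (-d))
  rw [quicksort]
  split_ifs with h
  · rw [PMF.toOuterMeasure_pure_apply, if_neg]
    · exact zero_le
    · rw [Set.mem_ofPred_eq, not_not]
      refine ⟨S.nodup_toList, fun x => Finset.mem_toList, ?_⟩
      have hlen : S.toList.length ≤ 1 := by rw [Finset.length_toList]; omega
      match S.toList, hlen with
      | [], _ => exact List.Pairwise.nil
      | [a], _ => exact List.pairwise_singleton _ _
  · have : Nonempty S := (Finset.card_pos.mp (by omega)).to_subtype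
    rw [← zero_add ((S.card : ℝ≥0∞) ^ 2 * ε)]
    refine toOuterMeasure_bind_le _ _ (A := ∅) (by simp) fun p _ => ?_
    set T := S.erase (p : Fin n) with hT
    have hTS : T.card + 1 = S.card := Finset.card_erase_add_one p.2
    calc _ ≤ T.card * ε + (T.card : ℝ≥0∞) ^ 2 * ε := ?_
      _ = ((T.card * (T.card + 1) : ℕ) : ℝ≥0∞) * ε := by push_cast; ring
      _ ≤ ((S.card ^ 2 : ℕ) : ℝ≥0∞) * ε := by
          gcongr
          rw [← hTS]
          nlinarith
      _ = _ := by push_cast; ring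
    refine toOuterMeasure_bind_le _ _ (partition_not_isAccurate_le θ hd p T) fun L hL => ?_
    rw [Set.mem_ofPred_eq, not_not] at hL
    have hLT : (L : Finset (Fin n)) ⊆ T := Finset.mem_powerset.mp L.2
    have hcard : (T \ (L : Finset (Fin n))).card + (L : Finset (Fin n)).card = T.card :=
      Finset.card_sdiff_add_card_eq_card hLT
    set a := (L : Finset (Fin n)).card
    set b := (T \ (L : Finset (Fin n))).card
    calc _ ≤ (a : ℝ≥0∞) ^ 2 * ε + ((b : ℝ≥0∞) ^ 2 * ε + 0) := ?_
      _ = ((a ^ 2 + b ^ 2 : ℕ) : ℝ≥0∞) * ε := by push_cast; ring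
      _ ≤ ((T.card ^ 2 : ℕ) : ℝ≥0∞) * ε := by
          gcongr
          rw [← hcard]
          nlinarith
      _ = _ := by push_cast; ring
    refine toOuterMeasure_bind_le _ _ (ih a (by omega) L rfl) fun l hl => ?_
    refine toOuterMeasure_bind_le _ _ (ih b (by omega) (T \ L) rfl) fun r hr => ?_
    rw [Set.mem_ofPred_eq, not_not] at hl hr
    rw [PMF.toOuterMeasure_pure_apply, if_neg]
    rw [Set.mem_ofPred_eq, not_not]
    exact IsNearlySorted.append_cons hd p.2 hLT hL hl hr

/-! ### Random parameters -/

/-- Averaging over the parameters: a uniform bound for `quicksort` on a set of parameters bounds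
the probability of the output. The sum over the lists and the integral are exchanged by
superadditivity of the lower integral, which needs no measurability of `quicksort` in `θ`. -/
theorem IsQuicksortOutput.measure_inter_le {Ω : Type*} [MeasurableSpace Ω] {n : ℕ} {P : Measure Ω}
    [IsProbabilityMeasure P] {θ : Ω → Fin n → ℝ} {out : Ω → List (Fin n)}
    (hout : IsQuicksortOutput P θ out) (hθ : Measurable θ) {A : Set (Fin n → ℝ)}
    (hA : MeasurableSet A) (B : Set (List (Fin n))) {c : ℝ≥0∞}
    (h : ∀ ϑ ∈ A, (quicksort ϑ Finset.univ).toOuterMeasure B ≤ c) :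
    P (θ ⁻¹' A ∩ out ⁻¹' B) ≤ c := by
  have hsum : ∀ F : Finset B, ∑ l ∈ F, P (θ ⁻¹' A ∩ {ω | out ω = l}) ≤
      ∫⁻ ω in θ ⁻¹' A, ∑ l ∈ F, quicksort (θ ω) Finset.univ l ∂P := by
    classical
    intro F
    induction F using Finset.induction_on with
    | empty => simp
    | insert l F hl ih =>
      simp only [Finset.sum_insert hl]
      refine le_trans (add_le_add (hout.2 A hA l).le ih) (le_lintegral_add _ _)
  have hunion : θ ⁻¹' A ∩ out ⁻¹' B = ⋃ l : B, θ ⁻¹' A ∩ {ω | out ω = l} := by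
    ext ω
    simp
  rw [hunion]
  refine (measure_iUnion_le _).trans (ENNReal.summable.tsum_le_of_sum_le fun F => (hsum F).trans ?_)
  calc _ ≤ ∫⁻ _ω in θ ⁻¹' A, c ∂P := by
        refine setLIntegral_mono' (hθ hA) fun ω hω => le_trans ?_ (h (θ ω) hω)
        rw [PMF.toOuterMeasure_apply, ← tsum_subtype B (quicksort (θ ω) Finset.univ)]
        exact ENNReal.sum_le_tsum F
    _ ≤ c := by
        rw [setLIntegral_const]
        exact mul_le_of_le_one_right' prob_le_one

theorem lintegral_exp_neg_expMeasure {lam : ℝ} (hlam : 0 < lam) :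
    ∫⁻ x, ENNReal.ofReal (Real.exp (-lam * x)) ∂(expMeasure lam) = 2⁻¹ := by
  have hpdf : ∀ r, expMeasure r = volume.withDensity (exponentialPDF r) := fun r => rfl
  have hm : ∀ r, Measurable (exponentialPDF r) := fun r =>
    (measurable_exponentialPDFReal r).ennreal_ofReal
  rw [hpdf, lintegral_withDensity_eq_lintegral_mul _ (hm lam) (by fun_prop)]
  -- Tilting by `exp (-lam * x)` turns the density of rate `lam` into half that of rate `2 * lam`.
  calc _ = ∫⁻ x, 2⁻¹ * exponentialPDF (2 * lam) x := by
        refine lintegral_congr fun x => ?_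
        rw [Pi.mul_apply, exponentialPDF_eq, exponentialPDF_eq,
          ← ENNReal.ofReal_mul' (Real.exp_pos _).le,
          show (2⁻¹ : ℝ≥0∞) = ENNReal.ofReal 2⁻¹ by
            rw [ENNReal.ofReal_inv_of_pos two_pos]; simp,
          ← ENNReal.ofReal_mul (by norm_num)]
        congr 1
        split_ifs
        · rw [mul_assoc, ← Real.exp_add]
          ring_nf
        · simp
    _ = 2⁻¹ := by
        rw [lintegral_const_mul _ (hm _), lintegral_exponentialPDF_eq_one (by positivity), mul_one]

theorem hasLaw_expMeasure_integrable_exp {Ω : Type*} [MeasurableSpace Ω] {P : Measure Ω}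
    {X : Ω → ℝ} {lam : ℝ} (hlam : 0 < lam) (hX : HasLaw X (expMeasure lam) P) :
    Integrable (fun ω => Real.exp (-lam * X ω)) P ∧ mgf X P (-lam) = 2⁻¹ := by
  have hm : AEStronglyMeasurable (fun ω => Real.exp (-lam * X ω)) P :=
    (Real.measurable_exp.comp_aemeasurable (hX.aemeasurable.const_mul _)).aestronglyMeasurable
  have hint : ∫⁻ ω, ENNReal.ofReal (Real.exp (-lam * X ω)) ∂P = 2⁻¹ := by
    rw [← lintegral_exp_neg_expMeasure hlam, ← hX.map_eq, lintegral_map' (by fun_prop)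
      hX.aemeasurable]
  have hpos : 0 ≤ᵐ[P] fun ω => Real.exp (-lam * X ω) := ae_of_all _ fun _ => (Real.exp_pos _).le
  refine ⟨⟨hm, ?_⟩, ?_⟩
  · rw [hasFiniteIntegral_iff_ofReal hpos, hint]
    simp
  · rw [mgf, integral_eq_lintegral_of_nonneg_ae hpos hm, hint]
    simp

theorem hasLaw_expMeasure_ae_nonneg {Ω : Type*} [MeasurableSpace Ω] {P : Measure Ω}
    {X : Ω → ℝ} {lam : ℝ} (hX : HasLaw X (expMeasure lam) P) :
    ∀ᵐ ω ∂P, 0 ≤ X ω := by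
  have h : P (X ⁻¹' Set.Iio 0) = 0 := by
    rw [← Measure.map_apply_of_aemeasurable hX.aemeasurable measurableSet_Iio, hX.map_eq,
      show expMeasure lam = volume.withDensity (exponentialPDF lam) from rfl,
      withDensity_apply _ measurableSet_Iio]
    exact lintegral_exponentialPDF_of_nonpos le_rfl
  rw [ae_iff]
  convert h using 2
  ext ω
  simp

/-- Chernoff bound for the lower tail of a sum of independent exponential variables. -/
theorem measure_sum_exponential_le {Ω ι : Type*} [MeasurableSpace Ω] {P : Measure Ω}
    [IsProbabilityMeasure P] {X : ι → Ω → ℝ} {lam : ℝ} (hlam : 0 < lam)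
    (hindep : iIndepFun X P) (hmeas : ∀ i, Measurable (X i))
    (hlaw : ∀ i, HasLaw (X i) (expMeasure lam) P) (s : Finset ι) (a : ℝ) :
    P.real {ω | (∑ i ∈ s, X i) ω ≤ a} ≤ Real.exp (lam * a) * 2⁻¹ ^ s.card := by
  refine (measure_le_le_exp_mul_mgf a (t := -lam) (by linarith)
    (hindep.integrable_exp_mul_sum hmeas fun i _ =>
      (hasLaw_expMeasure_integrable_exp hlam (hlaw i)).1)).trans ?_
  rw [hindep.mgf_sum hmeas, neg_neg, Finset.prod_congr rfl fun i _ =>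
    (hasLaw_expMeasure_integrable_exp hlam (hlaw i)).2, Finset.prod_const]

theorem sum_gap {n : ℕ} (θ : Fin n → ℝ) {i m : ℕ} (h : i + m < n) :
    ∑ k ∈ Finset.univ.filter (fun k : Fin (n - 1) => i ≤ k ∧ (k : ℕ) < i + m), gap θ k =
      θ ⟨i, by omega⟩ - θ ⟨i + m, h⟩ := by
  induction m with
  | zero =>
    rw [Finset.filter_false_of_mem (fun k _ => by omega)]
    simp
  | succ m ih =>
    have : Finset.univ.filter (fun k : Fin (n - 1) => i ≤ k ∧ (k : ℕ) < i + (m + 1)) =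
        insert ⟨i + m, by omega⟩
          (Finset.univ.filter (fun k : Fin (n - 1) => i ≤ k ∧ (k : ℕ) < i + m)) := by
      ext k
      simp only [Finset.mem_filter, Finset.mem_univ, true_and, Finset.mem_insert, Fin.ext_iff]
      omega
    rw [this, Finset.sum_insert (by simp), ih (by omega)]
    simp only [gap]
    ring_nf

theorem card_filter_gap {n i m : ℕ} (h : i + m < n) :
    (Finset.univ.filter (fun k : Fin (n - 1) => i ≤ k ∧ (k : ℕ) < i + m)).card = m := by
  rw [← Finset.card_map Fin.valEmbedding]
  have : (Finset.univ.filter (fun k : Fin (n - 1) => i ≤ k ∧ (k : ℕ) < i + m)).map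
      Fin.valEmbedding = Finset.Ico i (i + m) := by
    ext k
    simp only [Finset.mem_map, Finset.mem_filter, Finset.mem_univ, true_and,
      Fin.valEmbedding_apply, Finset.mem_Ico]
    constructor
    · rintro ⟨j, hj, rfl⟩
      exact hj
    · intro hk
      exact ⟨⟨k, by omega⟩, hk, rfl⟩
  rw [this, Nat.card_Ico]
  omega

theorem antitone_of_gap_nonneg {n : ℕ} {θ : Fin n → ℝ} (h : ∀ i, 0 ≤ gap θ i) : Antitone θ := by
  intro i j hij
  obtain ⟨m, hm⟩ := Nat.exists_eq_add_of_le (Fin.le_def.mp hij)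
  have hj : j = ⟨i + m, hm ▸ j.2⟩ := Fin.ext hm
  have := sum_gap θ (i := i) (m := m) (hm ▸ j.2)
  rw [hj]
  have hpos := Finset.sum_nonneg fun k (_ : k ∈ Finset.univ.filter
    (fun k : Fin (n - 1) => (i : ℕ) ≤ k ∧ (k : ℕ) < i + m)) => h k
  linarith

/-- With high probability, any two items whose ranks differ by at least `m` have parameters at
distance at least `a`. -/
theorem measure_not_spread_le {Ω : Type*} [MeasurableSpace Ω] {n : ℕ} {P : Measure Ω}
    [IsProbabilityMeasure P] {θ : Ω → Fin n → ℝ} {lam : ℝ} (hlam : 0 < lam) (hθ : Measurable θ)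
    (hindep : iIndepFun (fun (i : Fin (n - 1)) (ω : Ω) => gap (θ ω) i) P)
    (hlaw : ∀ i : Fin (n - 1), HasLaw (fun ω => gap (θ ω) i) (expMeasure lam) P)
    (m : ℕ) (a : ℝ) :
    P.real {ω | ¬ ∀ i j : Fin n, (i : ℕ) + m ≤ j → a ≤ θ ω i - θ ω j} ≤
      n * (Real.exp (lam * a) * 2⁻¹ ^ m) := by
  have hmeas : ∀ i : Fin (n - 1), Measurable fun ω => gap (θ ω) i := fun i => by
    unfold gap
    fun_prop
  let s : Fin n → Finset (Fin (n - 1)) := fun i =>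
    Finset.univ.filter fun k => (i : ℕ) ≤ k ∧ (k : ℕ) < i + m
  let E : Fin n → Set Ω := fun i =>
    {ω | (i : ℕ) + m < n ∧ (∑ k ∈ s i, fun ω => gap (θ ω) k) ω ≤ a}
  have hE : ∀ i, P.real (E i) ≤ Real.exp (lam * a) * 2⁻¹ ^ m := by
    intro i
    by_cases hi : (i : ℕ) + m < n
    · have := measure_sum_exponential_le hlam hindep hmeas hlaw (s i) a
      rw [card_filter_gap hi] at this
      refine le_trans (measureReal_mono fun ω hω => ?_) this
      exact hω.2
    · have : E i = ∅ := by
        ext ω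
        simp [E, hi]
      rw [this, measureReal_empty]
      positivity
  have hsub : {ω | ¬ ∀ i j : Fin n, (i : ℕ) + m ≤ j → a ≤ θ ω i - θ ω j} ≤ᵐ[P]
      ⋃ i ∈ Finset.univ, E i := by
    filter_upwards [ae_all_iff.mpr fun i => hasLaw_expMeasure_ae_nonneg (hlaw i)] with ω hω hbad
    have hbad' : ¬ ∀ i j : Fin n, (i : ℕ) + m ≤ j → a ≤ θ ω i - θ ω j := hbad
    push Not at hbad'
    obtain ⟨i, j, hij, hlt⟩ := hbad'
    have him : (i : ℕ) + m < n := by omega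
    have hanti := antitone_of_gap_nonneg hω (show (⟨i + m, him⟩ : Fin n) ≤ j from hij)
    change ω ∈ ⋃ i ∈ Finset.univ, E i
    simp only [Set.mem_iUnion]
    refine ⟨i, Finset.mem_univ i, him, ?_⟩
    rw [Finset.sum_apply, sum_gap (θ ω) him]
    simp only [Fin.eta]
    linarith
  calc _ ≤ P.real (⋃ i ∈ Finset.univ, E i) := ENNReal.toReal_mono (by simp) (measure_mono_ae hsub)
    _ ≤ ∑ i, P.real (E i) := measureReal_biUnion_finset_le _ _
    _ ≤ ∑ _i : Fin n, Real.exp (lam * a) * 2⁻¹ ^ m := Finset.sum_le_sum fun i _ => hE i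
    _ = _ := by simp

/-- The two sources of failure: parameters that are not spread out, and a wrong comparison of items
at distance at least `d`. -/
theorem measure_lt_maxDisplacement_le {Ω : Type*} [MeasurableSpace Ω] {n : ℕ} {P : Measure Ω}
    [IsProbabilityMeasure P] {θ : Ω → Fin n → ℝ} {out : Ω → List (Fin n)} {lam : ℝ}
    (hlam : 0 < lam) (hθ : Measurable θ)
    (hindep : iIndepFun (fun (i : Fin (n - 1)) (ω : Ω) => gap (θ ω) i) P)
    (hlaw : ∀ i : Fin (n - 1), HasLaw (fun ω => gap (θ ω) i) (expMeasure lam) P)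
    (hout : IsQuicksortOutput P θ out) (m : ℕ) {d : ℝ} (hd : 0 < d) :
    P.real {ω | m < maxDisplacement (out ω)} ≤
      n * (Real.exp (lam * (2 * d)) * 2⁻¹ ^ m) + n ^ 2 * Real.exp (-d) := by
  let A : Set (Fin n → ℝ) := {ϑ | ∀ i j : Fin n, (i : ℕ) + m ≤ j → 2 * d ≤ ϑ i - ϑ j}
  have hA : MeasurableSet A := by
    simp only [A, Set.ofPred_forall]
    refine MeasurableSet.iInter fun i => MeasurableSet.iInter fun j => MeasurableSet.iInter fun _ =>
      measurableSet_le measurable_const (by fun_prop)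
  let B : Set (List (Fin n)) := {l | m < maxDisplacement l}
  have hB : ∀ ϑ ∈ A, (quicksort ϑ Finset.univ).toOuterMeasure B ≤
      (n : ℝ≥0∞) ^ 2 * ENNReal.ofReal (Real.exp (-d)) := by
    intro ϑ hϑ
    have := quicksort_not_isNearlySorted_le ϑ hd Finset.univ
    rw [Finset.card_univ, Fintype.card_fin] at this
    refine le_trans ((quicksort ϑ Finset.univ).toOuterMeasure.mono fun l hl => ?_) this
    exact fun hl' => absurd (IsNearlySorted.maxDisplacement_le hl' hϑ) (not_le.mpr hl)
  have h2 : P.real (θ ⁻¹' A ∩ out ⁻¹' B) ≤ n ^ 2 * Real.exp (-d) := by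
    have := ENNReal.toReal_mono (by finiteness) (hout.measure_inter_le hθ hA B hB)
    rwa [ENNReal.toReal_mul, ENNReal.toReal_pow, ENNReal.toReal_natCast,
      ENNReal.toReal_ofReal (Real.exp_pos _).le] at this
  calc _ ≤ P.real ((θ ⁻¹' A)ᶜ ∪ (θ ⁻¹' A ∩ out ⁻¹' B)) := by
        refine measureReal_mono fun ω hω => ?_
        by_cases h : ω ∈ θ ⁻¹' A
        · exact Or.inr ⟨h, hω⟩
        · exact Or.inl h
    _ ≤ _ := (measureReal_union_le _ _).trans
        (add_le_add (measure_not_spread_le hlam hθ hindep hlaw m (2 * d)) h2)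

end NoisyQuicksort

open NoisyQuicksort in
theorem mainTheorem2 :
    ∃ c > (0 : ℝ), ∃ α > (0 : ℝ), ∀ lam₀ > (0 : ℝ), ∃ C > (0 : ℝ),
      ∀ (lam : ℝ), lam₀ ≤ lam → ∀ (n : ℕ), 1 ≤ n →
      ∀ {Ω : Type*} [MeasurableSpace Ω] (P : Measure Ω) [IsProbabilityMeasure P]
        (θ : Ω → Fin n → ℝ) (out : Ω → List (Fin n)),
        Measurable θ →
        iIndepFun (fun (i : Fin (n - 1)) (ω : Ω) => NoisyQuicksort.gap (θ ω) i) P →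
        (∀ i : Fin (n - 1), HasLaw (fun ω => NoisyQuicksort.gap (θ ω) i) (expMeasure lam) P) →
        NoisyQuicksort.IsQuicksortOutput P θ out →
        1 - c / (n : ℝ) ^ α ≤
          P.real {ω | (NoisyQuicksort.maxDisplacement (out ω) : ℝ) ≤
            C * lam * Real.log n ^ 2} := by
  have hl2 : 0 < Real.log 2 := Real.log_pos one_lt_two
  refine ⟨2, two_pos, 1, one_pos, fun lam₀ hlam₀ => ?_⟩
  set M : ℝ := (6 + 2 / lam₀) / Real.log 2 with hM
  have hMpos : 0 < M := by positivity
  refine ⟨M / Real.log 2 + 1 / (lam₀ * Real.log 2 ^ 2), by positivity, ?_⟩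
  intro lam hlam n hn Ω _ P _ θ out hθ hindep hlaw hout
  have hlampos : 0 < lam := hlam₀.trans_le hlam
  rw [Real.rpow_one]
  rcases hn.eq_or_lt with rfl | hn2
  · refine le_trans ?_ measureReal_nonneg
    norm_num
  have hnpos : (0 : ℝ) < n := by positivity
  set x := Real.log n with hx
  have hx2 : Real.log 2 ≤ x := Real.log_le_log two_pos (by exact_mod_cast hn2)
  have hxpos : 0 < x := hl2.trans_le hx2
  have hexp : ∀ k : ℕ, Real.exp (-(k * x)) = 1 / (n : ℝ) ^ k := fun k => by
    rw [Real.exp_neg, Real.exp_nat_mul, hx, Real.exp_log hnpos, one_div]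
  set m : ℕ := ⌈M * lam * x⌉₊ with hm
  have hm1 : M * lam * x ≤ m := Nat.le_ceil _
  have hm2 : (m : ℝ) ≤ M * lam * x + 1 := (Nat.ceil_lt_add_one (by positivity)).le
  -- Since `x ≥ log 2`, one power of `x` pays for the rounding and for the factor `1 / log 2`.
  have hmC : (m : ℝ) ≤ (M / Real.log 2 + 1 / (lam₀ * Real.log 2 ^ 2)) * lam * x ^ 2 := by
    have e1 : M * lam * x ≤ M / Real.log 2 * lam * x ^ 2 := by
      have : 1 ≤ x / Real.log 2 := (one_le_div hl2).mpr hx2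
      calc M * lam * x = M * lam * x * 1 := (mul_one _).symm
        _ ≤ M * lam * x * (x / Real.log 2) := by gcongr
        _ = _ := by ring
    have e2 : 1 ≤ 1 / (lam₀ * Real.log 2 ^ 2) * lam * x ^ 2 := by
      rw [one_div_mul_eq_div, div_mul_eq_mul_div, one_le_div (by positivity)]
      gcongr
    linarith
  have hbound := measure_lt_maxDisplacement_le hlampos hθ hindep hlaw hout m
    (d := 3 * x) (by positivity)
  have hspread : Real.exp (lam * (2 * (3 * x))) * 2⁻¹ ^ m ≤ 1 / (n : ℝ) ^ 2 := by
    have h2 : (2⁻¹ : ℝ) ^ m = Real.exp (-(m * Real.log 2)) := by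
      rw [Real.exp_neg, Real.exp_nat_mul, Real.exp_log two_pos, inv_pow]
    rw [h2, ← Real.exp_add, ← hexp 2]
    refine Real.exp_le_exp.mpr ?_
    have e1 : M * lam * x * Real.log 2 ≤ m * Real.log 2 := by gcongr
    have e2 : M * lam * x * Real.log 2 = 6 * lam * x + 2 * (lam / lam₀) * x := by
      rw [hM]
      field_simp
    have e3 : 1 ≤ lam / lam₀ := (one_le_div hlam₀).mpr hlam
    have e4 : 2 * x ≤ 2 * (lam / lam₀) * x := by nlinarith
    push_cast
    linarith
  have hbad : P.real {ω | m < maxDisplacement (out ω)} ≤ 2 / n := by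
    have h3 := hexp 3
    push_cast at h3
    calc _ ≤ _ := hbound
      _ ≤ n * (1 / (n : ℝ) ^ 2) + n ^ 2 * (1 / (n : ℝ) ^ 3) := by
          rw [h3]
          gcongr
      _ = 2 / n := by
          field_simp
          norm_num
  have hcover : 1 ≤ P.real {ω | (maxDisplacement (out ω) : ℝ) ≤
      (M / Real.log 2 + 1 / (lam₀ * Real.log 2 ^ 2)) * lam * x ^ 2} +
        P.real {ω | m < maxDisplacement (out ω)} := by
    refine (probReal_univ (μ := P)).ge.trans
      (le_trans (measureReal_mono fun ω _ => ?_) (measureReal_union_le _ _))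
    rcases le_or_gt (maxDisplacement (out ω)) m with h | h
    · exact Or.inl ((Nat.cast_le.mpr h).trans hmC)
    · exact Or.inr h
  linarith
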